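/- A cooperative game is a pair $(P,v)$ of a finite set $P$ of players and a function $v:2^P\to\mathbb R$ with $v(\emptyset)=0$. It is monotone if $v(S)\le v(T)$ whenever $S\subseteq T\subseteq P$, and superadditive if $v(S\cup T)\ge v(S)+v(T)$ for all disjoint $S,T\subseteq P$. For $y\in\mathbb R^P$ write $y(S)=\sum_{p\in S}y_p$. The nucleolus of $(P,v)$ is the unique $y\in\mathbb R^P$ with $y(P)=v(P)$ that lexicographically maximizes, among all such vectors, the vector of the $2^{|P|}$ excesses $(y(S)-v(S))_{S\subseteq P}$ arranged in non-decreasing order. The packing game of a finite family $\mathcal S\subseteq 2^P$ with weights $w:\mathcal S\to\mathbb R$ is given by $$v(S)=\max\Big\{\sum_{i=1}^k w(S_i)\;:\;k\ge 0,\ S_1,\dots,S_k\in\mathcal S\text{ are pairwise disjoint subsets of }S\Big\}.$$ **Theorem.** For every $n\in\mathbb N=\{0,1,2,\dots\}$ and $\varepsilon>0$ there are monotone, superadditive games $(P,v)$ and $(P,\tilde v)$ with $|P|=O(n)$ as $n\to\infty$ ($P$ depending only on $n$) such that $|v(S)-\tilde v(S)|\le\varepsilon$ for all $S\subseteq P$,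 but the nucleoli $y$ of $(P,v)$ and $\tilde y$ of $(P,\tilde v)$ differ by exactly $2^n\varepsilon$ for some players, that is, $|y_s-\tilde y_s|=|y_t-\tilde y_t|=2^n\varepsilon$ for at least two players $s\ne t$. Explicitly, let $P=\{r\}\cup\{p^{(l)}_i,q^{(l)}_i : 1\le l\le n+2,\ 1\le i\le 4\}$, and let $c\ge\varepsilon$ and $K\ge 2^n\varepsilon$ be arbitrary reals. Then one may take for $v$ the packing game with weights $$w(\{r\})=c,\qquad w(\{r,p^{(1)}_i\})=c\quad(1\le i\le 4),\qquad w(\{p^{(l)}_i,q^{(l)}_i\})=2lK\quad(1\le l\le n+2,\ 1\le i\le 4),$$ $$w(\{q^{(l)}_1,q^{(l)}_2,q^{(l)}_3,q^{(l)}_4,p^{(l+1)}_i\})=4lK\quad(1\le l\le n+1,\ 1\le i\le 4),$$ and for $\tilde v$ the packing game with the same family and weights, except that $\tilde w(\{r\})=c-\varepsilon$. -/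

import Mathlib

open Filter Asymptotics

noncomputable section

/-- The total `y(S)` that an allocation `y ∈ ℝ^P` assigns to a coalition `S ⊆ P`. -/
def allocSum {P : Type} (y : P → ℝ) (S : Finset P) : ℝ := ∑ p ∈ S, y p

/-- A value function `v : 2^P → ℝ` is monotone: `v(S) ≤ v(T)` for all `S ⊆ T ⊆ P`. -/
def IsMonotoneGame {P : Type} (v : Finset P → ℝ) : Prop :=
  ∀ S T : Finset P, S ⊆ T → v S ≤ v T

/-- A value function is superadditive: `v(S ∪ T) ≥ v(S) + v(T)` for disjoint coalitions. -/
def IsSuperadditiveGame {P : Type} [DecidableEq P] (v : Finset P → ℝ) : Prop :=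
  ∀ S T : Finset P, Disjoint S T → v S + v T ≤ v (S ∪ T)

/-- The excess vector `θ(y)`: the excesses `y(S) - v(S)` of all `2^|P|` coalitions, with
repetitions, in non-decreasing order. -/
def excessVector {P : Type} [Fintype P] (v : Finset P → ℝ) (y : P → ℝ) : List ℝ :=
  ((Finset.univ : Finset (Finset P)).val.map fun S => allocSum y S - v S).sort (· ≤ ·)

/-- `y` lexicographically maximizes the excess vector among all `z ∈ ℝ^P` with `z(P) = v(P)`.
The order on `List ℝ` is the lexicographic one; all the lists compared here have length
`2^|P|`. -/
def IsNucleolus {P : Type} [Fintype P] (v : Finset P → ℝ) (y : P → ℝ) : Prop :=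
  allocSum y Finset.univ = v Finset.univ ∧
    ∀ z : P → ℝ, allocSum z Finset.univ = v Finset.univ →
      excessVector v z ≤ excessVector v y

open Classical in
/-- The value function of the packing game of a finite family of sets `A j ⊆ P` with weights
`w j`: the largest total weight of pairwise disjoint members of the family that are contained
in `S` (the empty packing is allowed). -/
def packingValue {ι P : Type} [Fintype ι] (A : ι → Finset P) (w : ι → ℝ)
    (S : Finset P) : ℝ :=
  ((Finset.univ : Finset (Finset ι)).filter fun I =>
      (I : Set ι).PairwiseDisjoint A ∧ ∀ j ∈ I, A j ⊆ S).sup'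
    ⟨∅, by simp⟩ (fun I => ∑ j ∈ I, w j)

/-- The players `r` and `p⁽ˡ⁾ᵢ`, `q⁽ˡ⁾ᵢ` for `n + 2` layers `l` and four indices `i`.
The layers `1, …, n + 2` are numbered from `0` here. -/
inductive Player (n : ℕ) : Type
  | r : Player n
  | p (l : Fin (n + 2)) (i : Fin 4) : Player n
  | q (l : Fin (n + 2)) (i : Fin 4) : Player n
  deriving DecidableEq, Fintype

/-- Names for the members of the set family of the example. -/
inductive Block (n : ℕ) : Type
  | root : Block n
  | rootEdge (i : Fin 4) : Block n
  | pair (l : Fin (n + 2)) (i : Fin 4) : Block n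
  | link (l : Fin (n + 1)) (i : Fin 4) : Block n
  deriving DecidableEq, Fintype

/-- The sets `{r}`, `{r, p⁽¹⁾ᵢ}`, `{p⁽ˡ⁾ᵢ, q⁽ˡ⁾ᵢ}` for `l ∈ [n+2]`, and
`{q⁽ˡ⁾₁, q⁽ˡ⁾₂, q⁽ˡ⁾₃, q⁽ˡ⁾₄, p⁽ˡ⁺¹⁾ᵢ}` for `l ∈ [n+1]`. -/
def blockSet (n : ℕ) : Block n → Finset (Player n)
  | .root => {.r}
  | .rootEdge i => {.r, .p 0 i}
  | .pair l i => {.p l i, .q l i}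
  | .link l i =>
      {.q l.castSucc 0, .q l.castSucc 1, .q l.castSucc 2, .q l.castSucc 3, .p l.succ i}

/-- The weights of these sets, with weight `a` for `{r}` and `c` for `{r, p⁽¹⁾ᵢ}`;
`l` counts the layers from `0`, so that the layer number in the weights is `l + 1`. -/
def blockWeight (n : ℕ) (a c K : ℝ) : Block n → ℝ
  | .root => a
  | .rootEdge _ => c
  | .pair l _ => 2 * ((l : ℕ) + 1) * K
  | .link l _ => 4 * ((l : ℕ) + 1) * K

end

/-!
The proof rests on Kohlberg's criterion (`isNucleolus_iff_of_balanced`): an efficient allocation `y`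
is the nucleolus as soon as, for every threshold `t`, a transfer `x` with `x(P) = 0` that lowers the
payoff of no coalition of excess at most `t` leaves the payoff of all these coalitions unchanged.

Both games of the example are treated at once, with weight `c - δ` for `{r}`; the nucleolus is
`layerAlloc n δ c K`, which gives `c - δ` to `r` and, with layers counted from `0`,
`(l + 1) K ± 2 ^ l δ / 2` to the players `p l i` (sign `+`) and `q l i` (sign `-`).
Write `level δ K l = (l + 1) K - 2 ^ l δ / 2`; under the assumption
`2 ^ n δ ≤ K` this is nonnegative and nondecreasing for `l ≤ n + 1`.

* The blocks `{r}` and `{p l i, q l i}` have excess `0` and partition the players. Hence a transfer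
  harming none of them fixes the payoff of each.
* In layer `l`, the coalition `{q l i}` has excess at most `level δ K l`, and so has the block that
  joins `p l i` to `r` (for `l = 0`) or to the previous layer. The former bounds `x (q l i)` from
  below, the latter bounds `x (p l i)` from below once the earlier layers are fixed. Since
  `x (p l i) + x (q l i) = 0`, layer `l` is fixed. Equating the two excesses is what doubles the
  deviation `2 ^ l δ / 2` from one layer to the next.
* No other coalition interferes: one containing exactly one of `p l i`, `q l i` has excess at least
  `level δ K l` (`level_le_excess_of_split`), because in any packing this player is either unused
  or covered by a block of at least that excess.

Comparing `δ = 0` with `δ = ε` in the last layer, `l = n + 1`, gives the difference `2 ^ n ε`.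
-/

open Filter Asymptotics

/-! ### Lexicographic comparison of sorted lists -/

theorem Multiset.sort_add_of_le {M N : Multiset ℝ} (h : ∀ a ∈ M, ∀ b ∈ N, a ≤ b) :
    (M + N).sort (· ≤ ·) = M.sort (· ≤ ·) ++ N.sort (· ≤ ·) := by
  refine List.Perm.eq_of_pairwise' (r := (· ≤ ·)) (Multiset.pairwise_sort _ _) ?_ ?_
  · refine List.pairwise_append.2
      ⟨Multiset.pairwise_sort _ _, Multiset.pairwise_sort _ _, fun a ha b hb => h a ?_ b ?_⟩
    · simpa using ha
    · simpa using hb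
  · rw [← Multiset.coe_eq_coe, ← Multiset.coe_add]
    simp only [Multiset.sort_eq]

theorem Multiset.sort_lt_sort_of_lt {M N : Multiset ℝ} (hN : N ≠ 0) {m : ℝ} (hm : m ∈ M)
    (h : ∀ b ∈ N, m < b) : M.sort (· ≤ ·) < N.sort (· ≤ ·) := by
  have hM' : m ∈ M.sort (· ≤ ·) := by simpa using hm
  have hMs := Multiset.pairwise_sort M (· ≤ ·)
  have hN' : N.sort (· ≤ ·) ≠ [] := fun h0 => hN (by
    rw [← Multiset.sort_eq N (· ≤ ·), h0]; rfl)
  have hNm : ∀ b ∈ N.sort (· ≤ ·), m < b := fun b hb => h b (by simpa using hb)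
  generalize M.sort (· ≤ ·) = L at *
  generalize N.sort (· ≤ ·) = L' at *
  cases L with
  | nil => simp at hM'
  | cons a L =>
    cases L' with
    | nil => exact absurd rfl hN'
    | cons b L' =>
      have ham : a ≤ m := by
        rcases List.mem_cons.1 hM' with rfl | hmL
        · exact le_rfl
        · exact (List.pairwise_cons.1 hMs).1 m hmL
      exact List.Lex.rel (lt_of_le_of_lt ham (hNm b (by simp)))

/-- If `f` agrees with `g` wherever `g < t`, and `f` is somewhere below `t` where `g` is not, then
the sorted values of `f` come lexicographically before those of `g`. -/
theorem sort_map_lt_sort_map {α : Type*} (A : Finset α) (f g : α → ℝ) (t : ℝ)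
    (hfg : ∀ a ∈ A, g a < t → f a = g a) {a₀ : α} (ha₀ : a₀ ∈ A) (hf : f a₀ < t)
    (hg : t ≤ g a₀) :
    (A.val.map f).sort (· ≤ ·) < (A.val.map g).sort (· ≤ ·) := by
  classical
  -- The lists first differ at the least value `s` of `f` at a point where `f` and `g` differ.
  obtain ⟨a₁, ha₁, hmin⟩ := (A.filter fun a => f a ≠ g a).exists_min_image f
    ⟨a₀, Finset.mem_filter.2 ⟨ha₀, (hf.trans_le hg).ne⟩⟩
  obtain ⟨ha₁A, ha₁ne⟩ := Finset.mem_filter.1 ha₁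
  have hst : f a₁ < t :=
    (hmin a₀ (Finset.mem_filter.2 ⟨ha₀, (hf.trans_le hg).ne⟩)).trans_lt hf
  set p : α → Prop := fun a => f a = g a ∧ f a ≤ f a₁ with hp
  have hf' : ∀ a ∈ A, ¬ p a → f a₁ ≤ f a := by
    intro a ha hpa
    by_cases h : f a = g a
    · exact le_of_not_ge fun h' => hpa ⟨h, h'⟩
    · exact hmin a (Finset.mem_filter.2 ⟨ha, h⟩)
  have hg' : ∀ a ∈ A, ¬ p a → f a₁ < g a := by
    intro a ha hpa
    by_cases h : f a = g a
    · rw [← h]; exact lt_of_not_ge fun h' => hpa ⟨h, h'⟩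
    · exact hst.trans_le (le_of_not_gt fun h' => h (hfg a ha h'))
  have split : ∀ k : α → ℝ, A.val.map k
      = (A.val.filter p).map k + (A.val.filter fun a => ¬ p a).map k := fun k => by
    rw [← Multiset.map_add, Multiset.filter_add_not]
  have hcommon : (A.val.filter p).map f = (A.val.filter p).map g :=
    Multiset.map_congr rfl fun a ha => (Multiset.mem_filter.1 ha).2.1
  have hmem : a₁ ∈ A.val.filter fun a => ¬ p a :=
    Multiset.mem_filter.2 ⟨ha₁A, fun h => ha₁ne h.1⟩
  rw [split f, split g, Multiset.sort_add_of_le, Multiset.sort_add_of_le, hcommon]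
  · refine List.append_left_lt (Multiset.sort_lt_sort_of_lt (m := f a₁) ?_ ?_ ?_)
    · intro h0
      rw [Multiset.map_eq_zero] at h0
      simp [h0] at hmem
    · exact Multiset.mem_map_of_mem _ hmem
    · intro b hb
      obtain ⟨a, ha, rfl⟩ := Multiset.mem_map.1 hb
      exact hg' a (Multiset.mem_filter.1 ha).1 (Multiset.mem_filter.1 ha).2
  · intro x hx y hy
    obtain ⟨a, ha, rfl⟩ := Multiset.mem_map.1 hx
    obtain ⟨b, hb, rfl⟩ := Multiset.mem_map.1 hy
    have h1 := (Multiset.mem_filter.1 ha).2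
    have h2 := hg' b (Multiset.mem_filter.1 hb).1 (Multiset.mem_filter.1 hb).2
    exact h1.1 ▸ h1.2.trans h2.le
  · intro x hx y hy
    obtain ⟨a, ha, rfl⟩ := Multiset.mem_map.1 hx
    obtain ⟨b, hb, rfl⟩ := Multiset.mem_map.1 hy
    exact (Multiset.mem_filter.1 ha).2.2.trans
      (hf' b (Multiset.mem_filter.1 hb).1 (Multiset.mem_filter.1 hb).2)

/-! ### Kohlberg's criterion -/

theorem allocSum_sub {P : Type} (z y : P → ℝ) (S : Finset P) :
    allocSum (z - y) S = allocSum z S - allocSum y S := by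
  simp [allocSum]

/-- Kohlberg's criterion for the nucleolus, in its sufficient direction and including uniqueness. -/
theorem isNucleolus_iff_of_balanced {P : Type} [Fintype P] {v : Finset P → ℝ} {y : P → ℝ}
    (hy : allocSum y Finset.univ = v Finset.univ)
    (hbal : ∀ (t : ℝ) (x : P → ℝ), allocSum x Finset.univ = 0 →
      (∀ S, allocSum y S - v S ≤ t → 0 ≤ allocSum x S) →
      ∀ S, allocSum y S - v S ≤ t → allocSum x S = 0) (z : P → ℝ) :
    IsNucleolus v z ↔ z = y := by
  have key : ∀ z : P → ℝ, allocSum z Finset.univ = v Finset.univ → z ≠ y →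
      excessVector v z < excessVector v y := by
    intro z hz hzy
    obtain ⟨a, ha⟩ := Function.ne_iff.1 hzy
    -- `S₁` has the least excess under `y` among the coalitions whose payoff changes.
    obtain ⟨S₁, hS₁, hmin⟩ := ((Finset.univ : Finset (Finset P)).filter fun S =>
      allocSum z S ≠ allocSum y S).exists_min_image (fun S => allocSum y S - v S)
      ⟨{a}, Finset.mem_filter.2 ⟨Finset.mem_univ _, by simpa [allocSum] using ha⟩⟩
    have hS₁ne := (Finset.mem_filter.1 hS₁).2
    have hlow : ∀ S, allocSum y S - v S < allocSum y S₁ - v S₁ →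
        allocSum z S = allocSum y S := by
      intro S hS
      by_contra hne
      exact absurd (hmin S (by simpa using hne)) (not_le.2 hS)
    obtain ⟨S₀, hS₀, hneg⟩ : ∃ S, allocSum y S - v S ≤ allocSum y S₁ - v S₁ ∧
        allocSum (z - y) S < 0 := by
      by_contra! hcon
      have := hbal _ (z - y) (by rw [allocSum_sub, hz, hy, sub_self]) hcon S₁ le_rfl
      rw [allocSum_sub] at this
      exact hS₁ne (sub_eq_zero.1 this)
    rw [allocSum_sub] at hneg
    have hS₀' : allocSum y S₁ - v S₁ ≤ allocSum y S₀ - v S₀ := by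
      refine le_of_not_gt fun h => ?_
      rw [hlow S₀ h, sub_self] at hneg
      exact lt_irrefl _ hneg
    exact sort_map_lt_sort_map Finset.univ (fun S => allocSum z S - v S)
      (fun S => allocSum y S - v S) (allocSum y S₁ - v S₁)
      (fun S _ hS => by simp only [hlow S hS]) (Finset.mem_univ S₀) (by linarith) hS₀'
  constructor
  · intro hz
    by_contra hne
    exact absurd (hz.2 y hy) (not_le.2 (key z hz.1 hne))
  · rintro rfl
    refine ⟨hy, fun x hx => ?_⟩
    by_cases h : x = z
    · rw [h]
    · exact (key x hx h).le

/-! ### Packing games -/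

section Packing

/-- The excess of a coalition `S` relative to one packing of `S` splits into the excesses of the
members of the packing and the payoff of the players of `S` left uncovered. -/
theorem allocSum_sub_sum_eq {ι P : Type} [DecidableEq P] {A : ι → Finset P}
    (w : ι → ℝ) (y : P → ℝ) {S : Finset P} {I : Finset ι} (hI : (I : Set ι).PairwiseDisjoint A)
    (hS : ∀ j ∈ I, A j ⊆ S) :
    allocSum y S - ∑ j ∈ I, w j =
      ∑ j ∈ I, (allocSum y (A j) - w j) + allocSum y (S \ I.biUnion A) := by
  have h := Finset.sum_sdiff (f := y) (Finset.biUnion_subset.2 hS)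
  rw [Finset.sum_biUnion hI] at h
  simp only [allocSum, Finset.sum_sub_distrib]
  linarith

variable {ι P : Type} [Fintype ι]

theorem packingValue_le_iff {A : ι → Finset P} {w : ι → ℝ} {S : Finset P} {b : ℝ} :
    packingValue A w S ≤ b ↔ ∀ I : Finset ι, (I : Set ι).PairwiseDisjoint A →
      (∀ j ∈ I, A j ⊆ S) → ∑ j ∈ I, w j ≤ b := by
  classical
  unfold packingValue
  simp [Finset.sup'_le_iff]

theorem le_packingValue {A : ι → Finset P} (w : ι → ℝ) {S : Finset P} {I : Finset ι}
    (hI : (I : Set ι).PairwiseDisjoint A) (hS : ∀ j ∈ I, A j ⊆ S) :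
    ∑ j ∈ I, w j ≤ packingValue A w S :=
  packingValue_le_iff.1 le_rfl I hI hS

theorem exists_packingValue_eq (A : ι → Finset P) (w : ι → ℝ) (S : Finset P) :
    ∃ I : Finset ι, (I : Set ι).PairwiseDisjoint A ∧ (∀ j ∈ I, A j ⊆ S) ∧
      packingValue A w S = ∑ j ∈ I, w j := by
  classical
  obtain ⟨I, hI, hmax⟩ := ((Finset.univ : Finset (Finset ι)).filter fun I : Finset ι =>
    (I : Set ι).PairwiseDisjoint A ∧ ∀ j ∈ I, A j ⊆ S).exists_max_image
    (fun I => ∑ j ∈ I, w j) ⟨∅, by simp⟩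
  obtain ⟨hI, hIS⟩ := (Finset.mem_filter.1 hI).2
  exact ⟨I, hI, hIS, le_antisymm (packingValue_le_iff.2 fun J hJ hJS =>
    hmax J (Finset.mem_filter.2 ⟨Finset.mem_univ _, hJ, hJS⟩)) (le_packingValue w hI hIS)⟩

theorem packingValue_nonneg (A : ι → Finset P) (w : ι → ℝ) (S : Finset P) :
    0 ≤ packingValue A w S := by
  simpa using le_packingValue (A := A) w (S := S) (I := ∅) (by simp) (by simp)

theorem le_packingValue_self (A : ι → Finset P) (w : ι → ℝ) (j : ι) :
    w j ≤ packingValue A w (A j) := by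
  simpa using le_packingValue (A := A) w (S := A j) (I := {j}) (by simp) (by simp)

theorem packingValue_empty {A : ι → Finset P} (hA : ∀ j, (A j).Nonempty) (w : ι → ℝ) :
    packingValue A w ∅ = 0 := by
  refine le_antisymm (packingValue_le_iff.2 fun I _ hS => ?_) (packingValue_nonneg _ _ _)
  have : I = ∅ := Finset.eq_empty_of_forall_notMem fun j hj =>
    (hA j).ne_empty (Finset.subset_empty.1 (hS j hj))
  simp [this]

theorem isMonotoneGame_packingValue (A : ι → Finset P) (w : ι → ℝ) :
    IsMonotoneGame (packingValue A w) := fun _ _ hST =>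
  packingValue_le_iff.2 fun _ hI hS => le_packingValue w hI fun j hj => (hS j hj).trans hST

theorem isSuperadditiveGame_packingValue [DecidableEq P] {A : ι → Finset P}
    (hA : ∀ j, (A j).Nonempty) (w : ι → ℝ) : IsSuperadditiveGame (packingValue A w) := by
  classical
  intro S T hST
  obtain ⟨I, hI, hIS, hIv⟩ := exists_packingValue_eq A w S
  obtain ⟨J, hJ, hJT, hJv⟩ := exists_packingValue_eq A w T
  have hIJ : ∀ i ∈ I, ∀ j ∈ J, Disjoint (A i) (A j) := fun i hi j hj =>
    hST.mono (hIS i hi) (hJT j hj)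
  have hdis : Disjoint I J := Finset.disjoint_left.2 fun j hj hj' =>
    (hA j).ne_empty (disjoint_self.1 (hIJ j hj j hj'))
  rw [hIv, hJv, ← Finset.sum_union hdis]
  refine le_packingValue w ?_ ?_
  · rw [Finset.coe_union, Set.pairwiseDisjoint_union]
    exact ⟨hI, hJ, fun i hi j hj _ => hIJ i hi j hj⟩
  · intro j hj
    rcases Finset.mem_union.1 hj with h | h
    · exact (hIS j h).trans Finset.subset_union_left
    · exact (hJT j h).trans Finset.subset_union_right

theorem packingValue_le_add {A : ι → Finset P} {w w' : ι → ℝ} {b : ℝ}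
    (h : ∀ I : Finset ι, ∑ j ∈ I, w j ≤ ∑ j ∈ I, w' j + b) (S : Finset P) :
    packingValue A w S ≤ packingValue A w' S + b :=
  packingValue_le_iff.2 fun I hI hS => (h I).trans (by linarith [le_packingValue w' hI hS])

/-- If payoffs and the excesses of all blocks are nonnegative, then the excess of `S` is at least
`b` as soon as some player of `S` receives at least `b` and is contained only in
blocks within `S` of excess at least `b`. -/
theorem le_excess_of_mem {A : ι → Finset P} {w : ι → ℝ} {y : P → ℝ}
    (hy : ∀ a, 0 ≤ y a) (hw : ∀ j, w j ≤ allocSum y (A j)) {S : Finset P} {b : ℝ} {a : P}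
    (ha : a ∈ S) (hya : b ≤ y a)
    (hb : ∀ j, A j ⊆ S → a ∈ A j → b ≤ allocSum y (A j) - w j) :
    b ≤ allocSum y S - packingValue A w S := by
  classical
  obtain ⟨I, hI, hIS, hIv⟩ := exists_packingValue_eq A w S
  rw [hIv, allocSum_sub_sum_eq w y hI hIS]
  have h1 : 0 ≤ ∑ j ∈ I, (allocSum y (A j) - w j) :=
    Finset.sum_nonneg fun j _ => sub_nonneg.2 (hw j)
  have h2 : 0 ≤ allocSum y (S \ I.biUnion A) := Finset.sum_nonneg fun a _ => hy a
  by_cases hc : ∃ j ∈ I, a ∈ A j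
  · obtain ⟨j, hj, haj⟩ := hc
    have h3 := Finset.single_le_sum (f := fun j => allocSum y (A j) - w j)
      (fun j _ => sub_nonneg.2 (hw j)) hj
    have h4 := hb j (hIS j hj) haj
    linarith
  · have h3 : y a ≤ allocSum y (S \ I.biUnion A) :=
      Finset.single_le_sum (f := y) (fun a _ => hy a)
        (Finset.mem_sdiff.2 ⟨ha, fun h => hc (by simpa using h)⟩)
    linarith

theorem packingValue_le_allocSum {A : ι → Finset P} {w : ι → ℝ} {y : P → ℝ}
    (hy : ∀ a, 0 ≤ y a) (hw : ∀ j, w j ≤ allocSum y (A j)) (S : Finset P) :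
    packingValue A w S ≤ allocSum y S := by
  classical
  refine packingValue_le_iff.2 fun I hI hIS => sub_nonneg.1 ?_
  rw [allocSum_sub_sum_eq w y hI hIS]
  exact add_nonneg (Finset.sum_nonneg fun j _ => sub_nonneg.2 (hw j))
    (Finset.sum_nonneg fun a _ => hy a)

end Packing

/-! ### The layered example -/

theorem blockSet_nonempty (n : ℕ) (j : Block n) : (blockSet n j).Nonempty := by
  cases j <;> simp [blockSet]

/-- The players are `r`, the `p l i` and the `q l i`. -/
def playerEquiv (n : ℕ) :
    Player n ≃ Unit ⊕ ((Fin (n + 2) × Fin 4) ⊕ (Fin (n + 2) × Fin 4)) where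
  toFun
    | .r => .inl ()
    | .p l i => .inr (.inl (l, i))
    | .q l i => .inr (.inr (l, i))
  invFun
    | .inl _ => .r
    | .inr (.inl (l, i)) => .p l i
    | .inr (.inr (l, i)) => .q l i
  left_inv a := by cases a <;> rfl
  right_inv a := by rcases a with _ | _ | _ <;> rfl

theorem card_player (n : ℕ) : Fintype.card (Player n) = 8 * n + 17 := by
  rw [Fintype.card_congr (playerEquiv n)]
  simp
  ring

theorem sum_player {n : ℕ} (f : Player n → ℝ) :
    ∑ a, f a = f .r + ∑ l, ∑ i, (f (.p l i) + f (.q l i)) := by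
  rw [← (playerEquiv n).symm.sum_comp]
  simp [playerEquiv, Fintype.sum_prod_type, Finset.sum_add_distrib]

theorem allocSum_player {n : ℕ} (x : Player n → ℝ) (S : Finset (Player n)) :
    allocSum x S = (if .r ∈ S then x .r else 0) + ∑ l, ∑ i,
      ((if .p l i ∈ S then x (.p l i) else 0) + (if .q l i ∈ S then x (.q l i) else 0)) := by
  rw [← sum_player fun a => if a ∈ S then x a else 0]
  simp [allocSum]

theorem allocSum_root {n : ℕ} (x : Player n → ℝ) :
    allocSum x (blockSet n .root) = x .r := by
  simp [allocSum, blockSet]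

theorem allocSum_rootEdge {n : ℕ} (x : Player n → ℝ) (i : Fin 4) :
    allocSum x (blockSet n (.rootEdge i)) = x .r + x (.p 0 i) := by
  simp [allocSum, blockSet]

theorem allocSum_pair {n : ℕ} (x : Player n → ℝ) (l : Fin (n + 2)) (i : Fin 4) :
    allocSum x (blockSet n (.pair l i)) = x (.p l i) + x (.q l i) := by
  simp [allocSum, blockSet]

theorem allocSum_link {n : ℕ} (x : Player n → ℝ) (l : Fin (n + 1)) (i : Fin 4) :
    allocSum x (blockSet n (.link l i)) =
      ∑ k, x (.q l.castSucc k) + x (.p l.succ i) := by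
  simp [allocSum, blockSet, Fin.sum_univ_four]
  ring

/-- The deviation `2 ^ l δ / 2` from the symmetric payoff in layer `l`, counted from `0`. -/
noncomputable def deviation (δ : ℝ) (l : ℕ) : ℝ := 2 ^ l * δ / 2

/-- The payoff of the players `q l i`, which is also the least excess of a coalition that contains
exactly one of `p l i` and `q l i`. -/
noncomputable def level (δ K : ℝ) (l : ℕ) : ℝ := (l + 1) * K - deviation δ l

/-- The nucleolus of the example in which `{r}` has weight `c - δ`. -/
noncomputable def layerAlloc (n : ℕ) (δ c K : ℝ) : Player n → ℝ
  | .r => c - δ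
  | .p l _ => ((l : ℕ) + 1) * K + deviation δ l
  | .q l _ => level δ K l

theorem deviation_succ (δ : ℝ) (l : ℕ) : deviation δ (l + 1) = 2 * deviation δ l := by
  simp only [deviation, pow_succ]
  ring

section Example

variable {n : ℕ} {δ c K : ℝ}

theorem deviation_nonneg (hδ : 0 ≤ δ) (l : ℕ) : 0 ≤ deviation δ l := by
  unfold deviation
  positivity

theorem deviation_le (hδ : 0 ≤ δ) (hK : 2 ^ n * δ ≤ K) {l : ℕ} (hl : l ≤ n + 1) :
    deviation δ l ≤ K := by
  have h : (2 : ℝ) ^ l ≤ 2 ^ (n + 1) := pow_le_pow_right₀ (by norm_num) hl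
  have := mul_le_mul_of_nonneg_right h hδ
  rw [pow_succ] at this
  unfold deviation
  linarith

theorem level_le_succ (hδ : 0 ≤ δ) (hK : 2 ^ n * δ ≤ K) {l : ℕ} (hl : l ≤ n) :
    level δ K l ≤ level δ K (l + 1) := by
  have := deviation_le hδ hK (l := l) (by omega)
  simp only [level, deviation_succ]
  push_cast
  linarith

theorem level_nonneg (hδ : 0 ≤ δ) (hK : 2 ^ n * δ ≤ K) {l : ℕ} (hl : l ≤ n + 1) :
    0 ≤ level δ K l := by
  have h := deviation_le hδ hK hl
  have hK0 : 0 ≤ K := le_trans (by positivity) hK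
  have : 0 ≤ (l : ℝ) * K := by positivity
  simp only [level]
  linarith

theorem level_mono (hδ : 0 ≤ δ) (hK : 2 ^ n * δ ≤ K) {l m : ℕ} (hlm : l ≤ m) (hm : m ≤ n + 1) :
    level δ K l ≤ level δ K m := by
  induction m, hlm using Nat.le_induction with
  | base => exact le_rfl
  | succ m _ ih => exact (ih (by omega)).trans (level_le_succ hδ hK (by omega))

theorem layerAlloc_nonneg (hδ : 0 ≤ δ) (hc : δ ≤ c) (hK : 2 ^ n * δ ≤ K) (a : Player n) :
    0 ≤ layerAlloc n δ c K a := by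
  have hK0 : 0 ≤ K := le_trans (by positivity) hK
  cases a with
  | r => simpa [layerAlloc] using hc
  | p l i => exact add_nonneg (by positivity) (deviation_nonneg hδ _)
  | q l i => exact level_nonneg hδ hK (by omega)

theorem excess_root : allocSum (layerAlloc n δ c K) (blockSet n .root)
    - blockWeight n (c - δ) c K .root = 0 := by
  simp [allocSum_root, layerAlloc, blockWeight]

theorem excess_rootEdge (i : Fin 4) : allocSum (layerAlloc n δ c K) (blockSet n (.rootEdge i))
    - blockWeight n (c - δ) c K (.rootEdge i) = level δ K 0 := by
  simp [allocSum_rootEdge, layerAlloc, blockWeight, level, deviation]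
  ring

theorem excess_pair (l : Fin (n + 2)) (i : Fin 4) :
    allocSum (layerAlloc n δ c K) (blockSet n (.pair l i))
    - blockWeight n (c - δ) c K (.pair l i) = 0 := by
  simp [allocSum_pair, layerAlloc, blockWeight, level]
  ring

theorem excess_link (l : Fin (n + 1)) (i : Fin 4) :
    allocSum (layerAlloc n δ c K) (blockSet n (.link l i))
    - blockWeight n (c - δ) c K (.link l i) = level δ K (l + 1) := by
  simp [allocSum_link, layerAlloc, blockWeight, level, deviation_succ]
  ring

theorem blockWeight_le_allocSum (hδ : 0 ≤ δ) (hK : 2 ^ n * δ ≤ K) (j : Block n) :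
    blockWeight n (c - δ) c K j ≤ allocSum (layerAlloc n δ c K) (blockSet n j) := by
  refine sub_nonneg.1 ?_
  cases j with
  | root => exact excess_root.ge
  | rootEdge i => exact (level_nonneg hδ hK (by omega)).trans_eq (excess_rootEdge i).symm
  | pair l i => exact (excess_pair l i).ge
  | link l i => exact (level_nonneg hδ hK (by omega)).trans_eq (excess_link l i).symm

/-- The coalitions of small excess contain both or none of the two players of each pair: one that
separates a pair of layer `l` has excess at least `level δ K l`. -/
theorem level_le_excess_of_split (hδ : 0 ≤ δ) (hc : δ ≤ c) (hK : 2 ^ n * δ ≤ K)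
    {S : Finset (Player n)} {l : Fin (n + 2)} {i : Fin 4}
    (hS : ¬ (Player.p l i ∈ S ↔ Player.q l i ∈ S)) :
    level δ K l ≤ allocSum (layerAlloc n δ c K) S
      - packingValue (blockSet n) (blockWeight n (c - δ) c K) S := by
  have hy := layerAlloc_nonneg hδ hc hK
  have hw := blockWeight_le_allocSum (c := c) hδ hK
  by_cases hp : Player.p l i ∈ S
  · have hq : Player.q l i ∉ S := fun hq => hS ⟨fun _ => hq, fun _ => hp⟩
    refine le_excess_of_mem hy hw hp ?_ fun j hj hm => ?_
    · have := deviation_nonneg hδ (l : ℕ)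
      simp only [layerAlloc, level]
      linarith
    · cases j with
      | root => simp [blockSet] at hm
      | rootEdge k =>
        have hl : l = 0 := by simp [blockSet] at hm; exact hm.1
        subst hl
        exact (excess_rootEdge k).ge
      | pair m k =>
        have h : l = m ∧ i = k := by simpa [blockSet] using hm
        obtain ⟨rfl, rfl⟩ := h
        exact absurd (hj (by simp [blockSet])) hq
      | link m k =>
        have h : l = m.succ ∧ i = k := by simpa [blockSet] using hm
        obtain ⟨rfl, rfl⟩ := h
        rw [excess_link, Fin.val_succ]
  · have hq : Player.q l i ∈ S := by tauto
    refine le_excess_of_mem hy hw hq le_rfl fun j hj hm => ?_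
    cases j with
    | root => simp [blockSet] at hm
    | rootEdge k => simp [blockSet] at hm
    | pair m k =>
      have h : l = m ∧ i = k := by simpa [blockSet] using hm
      obtain ⟨rfl, rfl⟩ := h
      exact absurd (hj (by simp [blockSet])) hp
    | link m k =>
      have h : l = m.castSucc := by
        simp [blockSet] at hm
        tauto
      subst h
      rw [excess_link]
      exact level_le_succ hδ hK (by simp; omega)

/-- The blocks `{r}` and `{p l i, q l i}`, which partition the players. -/
def partitionBlocks (n : ℕ) : Finset (Block n) :=
  Finset.univ.filter fun j => j = .root ∨ ∃ l i, j = .pair l i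

theorem allocSum_layerAlloc_univ (hδ : 0 ≤ δ) (hc : δ ≤ c) (hK : 2 ^ n * δ ≤ K) :
    allocSum (layerAlloc n δ c K) Finset.univ
      = packingValue (blockSet n) (blockWeight n (c - δ) c K) Finset.univ := by
  refine le_antisymm ?_ (packingValue_le_allocSum (layerAlloc_nonneg hδ hc hK)
    (blockWeight_le_allocSum hδ hK) _)
  have hdis : (partitionBlocks n : Set (Block n)).PairwiseDisjoint (blockSet n) := by
    intro j hj k hk hjk
    simp only [partitionBlocks, Finset.coe_filter, Finset.mem_univ, true_and,
      Set.mem_ofPred_eq] at hj hk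
    rcases hj with rfl | ⟨l, i, rfl⟩ <;> rcases hk with rfl | ⟨m, k, rfl⟩
    · exact absurd rfl hjk
    · simp [Function.onFun, blockSet]
    · simp [Function.onFun, blockSet]
    · have : m = l → k ≠ i := by
        rintro rfl rfl
        exact hjk rfl
      simpa [Function.onFun, blockSet] using this
  have hcover : Finset.univ \ (partitionBlocks n).biUnion (blockSet n) = ∅ := by
    refine Finset.sdiff_eq_empty_iff_subset.2 fun a _ => Finset.mem_biUnion.2 ?_
    cases a with
    | r => exact ⟨.root, by simp [partitionBlocks], by simp [blockSet]⟩
    | p l i => exact ⟨.pair l i, by simp [partitionBlocks], by simp [blockSet]⟩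
    | q l i => exact ⟨.pair l i, by simp [partitionBlocks], by simp [blockSet]⟩
  have h := allocSum_sub_sum_eq (blockWeight n (c - δ) c K) (layerAlloc n δ c K) hdis
    (S := Finset.univ) fun j _ => Finset.subset_univ _
  have h0 : ∑ j ∈ partitionBlocks n, (allocSum (layerAlloc n δ c K) (blockSet n j)
      - blockWeight n (c - δ) c K j) = 0 := by
    refine Finset.sum_eq_zero fun j hj => ?_
    rcases (Finset.mem_filter.1 hj).2 with rfl | ⟨l, i, rfl⟩
    · exact excess_root
    · exact excess_pair l i
  rw [hcover, h0] at h
  have h' := le_packingValue (blockWeight n (c - δ) c K) hdis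
    (S := Finset.univ) fun j _ => Finset.subset_univ _
  simp only [allocSum, Finset.sum_empty] at h ⊢
  linarith

theorem isNucleolus_iff_layerAlloc (hδ : 0 ≤ δ) (hc : δ ≤ c) (hK : 2 ^ n * δ ≤ K)
    (z : Player n → ℝ) :
    IsNucleolus (packingValue (blockSet n) (blockWeight n (c - δ) c K)) z
      ↔ z = layerAlloc n δ c K := by
  refine isNucleolus_iff_of_balanced (allocSum_layerAlloc_univ hδ hc hK)
    (fun t x hx hpos S hS => ?_) z
  have ht : 0 ≤ t := (sub_nonneg.2 (packingValue_le_allocSum (layerAlloc_nonneg hδ hc hK)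
    (blockWeight_le_allocSum hδ hK) S)).trans hS
  have hblock : ∀ j : Block n, allocSum (layerAlloc n δ c K) (blockSet n j)
      - blockWeight n (c - δ) c K j ≤ t → 0 ≤ allocSum x (blockSet n j) := fun j hj =>
    hpos _ (by linarith [le_packingValue_self (blockSet n) (blockWeight n (c - δ) c K) j])
  -- The tight blocks `{r}` and `{p l i, q l i}` partition the players.
  have hr : 0 ≤ x .r := by
    simpa only [allocSum_root] using hblock .root (excess_root.trans_le ht)
  have hpair : ∀ l i, 0 ≤ x (.p l i) + x (.q l i) := fun l i => by
    simpa only [allocSum_pair] using hblock (.pair l i) ((excess_pair l i).trans_le ht)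
  have htot : x .r + ∑ l, ∑ i, (x (.p l i) + x (.q l i)) = 0 := by
    rw [← sum_player]; exact hx
  have hinner : ∀ l, 0 ≤ ∑ i, (x (.p l i) + x (.q l i)) := fun l =>
    Finset.sum_nonneg fun i _ => hpair l i
  have hr0 : x .r = 0 := by
    have := Finset.sum_nonneg fun l (_ : l ∈ Finset.univ) => hinner l
    linarith
  have hpair0 : ∀ l i, x (.p l i) + x (.q l i) = 0 := by
    rw [hr0, zero_add, Finset.sum_eq_zero_iff_of_nonneg fun l _ => hinner l] at htot
    intro l i
    exact (Finset.sum_eq_zero_iff_of_nonneg fun i _ => hpair l i).1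
      (htot l (Finset.mem_univ l)) i (Finset.mem_univ i)
  have hq : ∀ (l : Fin (n + 2)) (i : Fin 4), level δ K l ≤ t → 0 ≤ x (.q l i) := fun l i hl => by
    have := hpos {.q l i} (by
      have := packingValue_nonneg (blockSet n) (blockWeight n (c - δ) c K) {.q l i}
      simp only [allocSum, Finset.sum_singleton, layerAlloc]
      linarith)
    simpa [allocSum] using this
  have hlayer : ∀ l : Fin (n + 2), level δ K l ≤ t →
      ∀ i, x (.p l i) = 0 ∧ x (.q l i) = 0 := by
    intro l
    induction l using Fin.induction with
    | zero =>
      intro hl i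
      have h1 := hblock (.rootEdge i) ((excess_rootEdge i).trans_le hl)
      rw [allocSum_rootEdge, hr0] at h1
      have h2 := hq 0 i hl
      have h3 := hpair0 0 i
      constructor <;> linarith
    | succ l ih =>
      intro hl i
      have ih' := ih ((level_mono hδ hK (by simp) (by omega)).trans hl)
      have h1 := hblock (.link l i) ((excess_link l i).trans_le (by simpa using hl))
      rw [allocSum_link, Finset.sum_eq_zero fun k _ => (ih' k).2] at h1
      have h2 := hq l.succ i hl
      have h3 := hpair0 l.succ i
      constructor <;> linarith
  rw [allocSum_player, hr0, ite_self, zero_add]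
  refine Finset.sum_eq_zero fun l _ => Finset.sum_eq_zero fun i _ => ?_
  by_cases hsplit : (Player.p l i ∈ S ↔ Player.q l i ∈ S)
  · by_cases h : Player.p l i ∈ S
    · simp [h, hsplit.1 h, hpair0 l i]
    · simp [h, mt hsplit.2 h]
  · have h := hlayer l ((level_le_excess_of_split hδ hc hK hsplit).trans hS) i
    simp [h.1, h.2]

end Example

theorem abs_packingValue_sub_le (n : ℕ) {ε : ℝ} (hε : 0 ≤ ε) (c K : ℝ)
    (S : Finset (Player n)) :
    |packingValue (blockSet n) (blockWeight n c c K) S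
      - packingValue (blockSet n) (blockWeight n (c - ε) c K) S| ≤ ε := by
  have hdiff : ∀ I : Finset (Block n), ∑ j ∈ I, blockWeight n c c K j =
      ∑ j ∈ I, blockWeight n (c - ε) c K j + if .root ∈ I then ε else 0 := by
    intro I
    have : ∀ j : Block n, blockWeight n c c K j =
        blockWeight n (c - ε) c K j + if j = .root then ε else 0 := by
      intro j
      cases j <;> simp [blockWeight]
    simp_rw [this, Finset.sum_add_distrib, Finset.sum_ite_eq']
  have h1 := packingValue_le_add (A := blockSet n) (w := blockWeight n c c K)
    (w' := blockWeight n (c - ε) c K) (b := ε)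
    (fun I => by rw [hdiff]; split_ifs <;> linarith) S
  have h2 := packingValue_le_add (A := blockSet n) (w := blockWeight n (c - ε) c K)
    (w' := blockWeight n c c K) (b := 0)
    (fun I => by rw [hdiff]; split_ifs <;> linarith) S
  rw [abs_le]
  constructor <;> linarith

theorem card_player_isBigO :
    (fun n : ℕ => (Fintype.card (Player n) : ℝ)) =O[atTop] fun n : ℕ => (n : ℝ) := by
  refine IsBigO.of_bound 25 ?_
  filter_upwards [eventually_ge_atTop 1] with n hn
  have : (1 : ℝ) ≤ n := by exact_mod_cast hn
  rw [card_player, Real.norm_of_nonneg (by positivity), Real.norm_of_nonneg (by positivity)]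
  push_cast
  linarith

theorem mainTheorem4 :
    ((fun n : ℕ => (Fintype.card (Player n) : ℝ)) =O[atTop] fun n : ℕ => (n : ℝ)) ∧
    ∀ (n : ℕ) (ε : ℝ), 0 < ε → ∀ c K : ℝ, ε ≤ c → 2 ^ n * ε ≤ K →
      ∃ v v' : Finset (Player n) → ℝ,
        v = packingValue (blockSet n) (blockWeight n c c K) ∧
        v' = packingValue (blockSet n) (blockWeight n (c - ε) c K) ∧
        v ∅ = 0 ∧ v' ∅ = 0 ∧
        IsMonotoneGame v ∧ IsMonotoneGame v' ∧
        IsSuperadditiveGame v ∧ IsSuperadditiveGame v' ∧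
        (∀ S : Finset (Player n), |v S - v' S| ≤ ε) ∧
        ∃ y y' : Player n → ℝ,
          (∀ z : Player n → ℝ, IsNucleolus v z ↔ z = y) ∧
          (∀ z : Player n → ℝ, IsNucleolus v' z ↔ z = y') ∧
          ∃ s t : Player n, s ≠ t ∧
            |y s - y' s| = 2 ^ n * ε ∧ |y t - y' t| = 2 ^ n * ε := by
  refine ⟨card_player_isBigO, fun n ε hε c K hc hK => ⟨_, _, rfl, rfl,
    packingValue_empty (blockSet_nonempty n) _, packingValue_empty (blockSet_nonempty n) _,
    isMonotoneGame_packingValue _ _, isMonotoneGame_packingValue _ _,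
    isSuperadditiveGame_packingValue (blockSet_nonempty n) _,
    isSuperadditiveGame_packingValue (blockSet_nonempty n) _,
    abs_packingValue_sub_le n hε.le c K, layerAlloc n 0 c K, layerAlloc n ε c K, ?_,
    isNucleolus_iff_layerAlloc hε.le hc hK, .p (Fin.last _) 0, .p (Fin.last _) 1, by simp, ?_⟩⟩
  · have hK0 : 0 ≤ K := le_trans (by positivity) hK
    simpa only [sub_zero] using isNucleolus_iff_layerAlloc (n := n) (δ := 0) (c := c) (K := K)
      le_rfl (hε.le.trans hc) (by simpa using hK0)
  · have h : ∀ i, |layerAlloc n 0 c K (.p (Fin.last _) i) - layerAlloc n ε c K (.p (Fin.last _) i)|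
        = 2 ^ n * ε := by
      intro i
      have : layerAlloc n 0 c K (.p (Fin.last _) i) - layerAlloc n ε c K (.p (Fin.last _) i)
          = -(2 ^ n * ε) := by
        simp only [layerAlloc, deviation, Fin.val_last, pow_succ]
        ring
      rw [this, abs_neg, abs_of_nonneg (by positivity)]
    exact ⟨h 0, h 1⟩
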